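/- There are universal constants $C, c, \alpha > 0$ such that the following holds. Let $n \ge 2$, let $G$ be a connected simple graph on $[n] = \{1,\dots,n\}$ with maximum and minimum degrees $d_{\max}$ and $d_{\min}$, let $\kappa = d_{\max}/d_{\min}$, and let $\gamma = 1 - \lambda_2$ be the spectral gap of the transition matrix $D^{-1}B$ of the simple random walk on $G$, where $B$ is the adjacency matrix, $D$ the diagonal matrix of degrees, and $\lambda_2$ the second-largest eigenvalue of $D^{-1}B$. Let $\mathbf{w}^* \in \mathbf{R}_{>0}^n$, let $b = \max_{i,j} w_i^*/w_j^*$, and let $\mathbf{w}^*$ be scaled such that $w_i^* \in [1/b, 1]$ for all $i$. For every edge $\{i,j\}$ of $G$ we observe $k$ comparisons of $i$ and $j$; all comparisons are independent, and in each of them $i$ is preferred to $j$ with probability $w_i^*/(w_i^*+w_j^*)$ (Bradley--Terry model). If $$k \ge 4C^2\Bigl(1 + \frac{b^6\kappa^2}{d_{\max}\gamma^2}\log n\Bigr),$$ then with probability at least $1 - c/n^{\alpha}$ a maximum likelihood estimate exists, i.e. a maximizer of the likelihood over all positive weight vectors, and every maximum likelihood estimate $\hat{\mathbf{w}}$, scaled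 such that $\sum_i \hat w_i = \sum_i w_i^*$, satisfies $$\Vert \hat{\mathbf{w}} - \mathbf{w}^* \Vert_2 < C\,\frac{b^4\kappa}{\gamma}\sqrt{\frac{n\log n}{k\,d_{\max}}}.$$ -/

import Mathlib

open MeasureTheory

noncomputable section

namespace BradleyTerry

variable {n : ℕ}

/-- The transition matrix `D⁻¹ B` of the unbiased random walk on `G`, with `B` the adjacency
matrix and `D` the diagonal matrix of the degrees. -/
def walkMatrix (G : SimpleGraph (Fin n)) [DecidableRel G.Adj] : Matrix (Fin n) (Fin n) ℝ :=
  (G.degMatrix ℝ)⁻¹ * G.adjMatrix ℝ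

/-- The spectral gap `1 - λ₂` of an irreducible reversible transition matrix. All eigenvalues of
such a matrix are real and the eigenvalue `1` is simple, so that the second largest eigenvalue
`λ₂` is the largest eigenvalue other than `1`. -/
def spectralGap (P : Matrix (Fin n) (Fin n) ℝ) : ℝ :=
  1 - sSup {μ : ℝ | Module.End.HasEigenvalue (Matrix.toLin' P) μ ∧ μ ≠ 1}

/-- The dynamic range `max_{i,j} w_i / w_j`. -/
def dynamicRange (w : Fin n → ℝ) : ℝ :=
  ⨆ p : Fin n × Fin n, w p.1 / w p.2

/-- The compared pairs: the edges of `G`, each written once, as `(i, j)` with `i < j`. -/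
abbrev ComparedPair (G : SimpleGraph (Fin n)) : Type :=
  {p : Fin n × Fin n // p.1 < p.2 ∧ G.Adj p.1 p.2}

/-- The outcomes of `k` comparisons for every compared pair. For a pair `(i, j)` with `i < j`,
the value `true` means that `i` is preferred to `j`, and `false` that `j` is preferred to `i`. -/
abbrev Outcomes (G : SimpleGraph (Fin n)) (k : ℕ) : Type :=
  ComparedPair G × Fin k → Bool

/-- The probability that `i` is preferred to `j` under the weights `w`. -/
def prefProb (w : Fin n → ℝ) (i j : Fin n) : ℝ :=
  w i / (w i + w j)

/-- The law of one comparison of `i` and `j` under the weights `w` (`true`: `i` is preferred). -/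
def comparisonLaw (w : Fin n → ℝ) (i j : Fin n) : Measure Bool :=
  ENNReal.ofReal (prefProb w i j) • Measure.dirac true +
    ENNReal.ofReal (prefProb w j i) • Measure.dirac false

/-- The law of the data: all comparisons are independent and follow the Bradley-Terry model
with weights `w`. -/
def outcomeLaw (G : SimpleGraph (Fin n)) [DecidableRel G.Adj] (k : ℕ) (w : Fin n → ℝ) :
    Measure (Outcomes G k) :=
  Measure.pi fun c : ComparedPair G × Fin k => comparisonLaw w c.1.1.1 c.1.1.2

/-- The likelihood of the weights `v` given the outcomes `x`. -/
def likelihood (G : SimpleGraph (Fin n)) [DecidableRel G.Adj] {k : ℕ} (x : Outcomes G k)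
    (v : Fin n → ℝ) : ℝ :=
  ∏ c : ComparedPair G × Fin k,
    if x c = true then prefProb v c.1.1.1 c.1.1.2 else prefProb v c.1.1.2 c.1.1.1

/-- `v` is a maximum likelihood estimate: it maximizes the likelihood over all positive weight
vectors. -/
def IsMLEstimate (G : SimpleGraph (Fin n)) [DecidableRel G.Adj] {k : ℕ} (x : Outcomes G k)
    (v : Fin n → ℝ) : Prop :=
  (∀ i, 0 < v i) ∧ ∀ u : Fin n → ℝ, (∀ i, 0 < u i) → likelihood G x u ≤ likelihood G x v

/-- `v` is the maximum likelihood estimate on the scale of the true weights `w`. Weights are only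
determined up to a common positive factor, and this factor is chosen such that `v` and `w` have
the same sum, that is `v = (∑ i, w i) • π` with `π` the estimate that sums to one. -/
def IsScaledMLEstimate (G : SimpleGraph (Fin n)) [DecidableRel G.Adj] {k : ℕ}
    (w : Fin n → ℝ) (x : Outcomes G k) (v : Fin n → ℝ) : Prop :=
  IsMLEstimate G x v ∧ ∑ i, v i = ∑ i, w i

end BradleyTerry

end

noncomputable section

namespace BradleyTerry

variable {n : ℕ}

/-! Randomness enters only through the score at the true weights `w`. Each component is a sum of
independent centered outcomes, so by Hoeffding and a union bound all components are at most `t = √(k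
* dmax * log n)` in absolute value, except with probability `2 / n`. The rest is deterministic.

For an estimate `v` put `r i = v i / w i`. The likelihood equations at `v`, tested against `r ^ 2`,
turn `∑ r i ^ 2 * score w i` into a sum over comparisons of `(prefProb v - prefProb w) * (r i ^ 2 -
r j ^ 2)`. Each term is at least `(r i - r j) ^ 2 / (2 * b)`, whatever the range of `v`
(`sq_sub_le_mul_prefProb_sub`): the factor `r i + r j` from the squares cancels the dependence on
the size of `v`. Thus the score controls the Dirichlet form of `r`, and the Poincaré inequality of
the random walk controls the variation of `r` about its mean `m` (`sum_sq_sub_degreeMean_le`).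
Equality of the sums of `v` and `w` keeps `m` bounded and gives the error in `v` itself
(`sum_sq_sub_le_of_sum_eq`).

Existence uses the same two ingredients with an indicator in place of `r`: a set winning no
comparison against its complement would make the score too large. -/

/-! ### Dirichlet form, spectral gap and Poincaré inequality -/

theorem sum_adj_eq_sum_comparedPair (G : SimpleGraph (Fin n)) [DecidableRel G.Adj]
    (F : Fin n → Fin n → ℝ) :
    ∑ i, ∑ j, (if G.Adj i j then F i j else 0) =
      ∑ e : ComparedPair G, (F e.1.1 e.1.2 + F e.1.2 e.1.1) := by
  have h1 : ∑ e : ComparedPair G, (F e.1.1 e.1.2 + F e.1.2 e.1.1) =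
      ∑ p : Fin n × Fin n,
        if p.1 < p.2 ∧ G.Adj p.1 p.2 then F p.1 p.2 + F p.2 p.1 else 0 := by
    rw [← Finset.sum_filter]
    exact (Finset.sum_subtype _ (by simp) (fun p : Fin n × Fin n => F p.1 p.2 + F p.2 p.1)).symm
  have h2 : ∀ i j : Fin n, (if G.Adj i j then F i j else 0) =
      (if i < j ∧ G.Adj i j then F i j else 0) + (if j < i ∧ G.Adj j i then F i j else 0) := by
    intro i j
    rcases lt_trichotomy i j with h | h | h
    · simp [h, h.not_gt]
    · subst h; simp
    · simp [h, h.not_gt, G.adj_comm]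
  simp_rw [h1, Fintype.sum_prod_type, h2, Finset.sum_add_distrib]
  rw [Finset.sum_comm (f := fun i j => if j < i ∧ G.Adj j i then F i j else 0),
    ← Finset.sum_add_distrib]
  refine Finset.sum_congr rfl fun i _ => ?_
  rw [← Finset.sum_add_distrib]
  refine Finset.sum_congr rfl fun j _ => ?_
  split_ifs <;> simp

/-- The Dirichlet form of a graph. -/
def dirichletForm (G : SimpleGraph (Fin n)) [DecidableRel G.Adj] (f : Fin n → ℝ) : ℝ :=
  ∑ e : ComparedPair G, (f e.1.1 - f e.1.2) ^ 2

theorem dirichletForm_eq (G : SimpleGraph (Fin n)) [DecidableRel G.Adj] (f : Fin n → ℝ) :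
    dirichletForm G f = ∑ i, (G.degree i : ℝ) * f i ^ 2 -
      ∑ i, f i * (G.adjMatrix ℝ).mulVec f i := by
  have h : dirichletForm G f = Matrix.toLinearMap₂' ℝ (G.lapMatrix ℝ) f f := by
    rw [SimpleGraph.lapMatrix_toLinearMap₂',
      sum_adj_eq_sum_comparedPair G (fun i j => (f i - f j) ^ 2), dirichletForm, Finset.sum_div]
    exact Finset.sum_congr rfl fun e _ => by ring
  rw [h, Matrix.toLinearMap₂'_apply', ← Finset.sum_sub_distrib, dotProduct]
  refine Finset.sum_congr rfl fun i _ => ?_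
  rw [SimpleGraph.lapMatrix_mulVec_apply, SimpleGraph.adjMatrix_mulVec_apply]
  ring

theorem dirichletForm_nonneg (G : SimpleGraph (Fin n)) [DecidableRel G.Adj] (f : Fin n → ℝ) :
    0 ≤ dirichletForm G f :=
  Finset.sum_nonneg fun _ _ => sq_nonneg _

theorem eq_of_dirichletForm_eq_zero {G : SimpleGraph (Fin n)} [DecidableRel G.Adj]
    (hG : G.Connected) {f : Fin n → ℝ} (hf : dirichletForm G f = 0) (i j : Fin n) :
    f i = f j := by
  have h0 : ∀ a b, a < b → G.Adj a b → f a = f b := by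
    intro a b hab h
    have := (Finset.sum_eq_zero_iff_of_nonneg
      (fun (e : ComparedPair G) _ => sq_nonneg (f e.1.1 - f e.1.2))).1 hf ⟨(a, b), hab, h⟩
      (Finset.mem_univ _)
    exact sub_eq_zero.1 (pow_eq_zero_iff two_ne_zero |>.1 this)
  have h1 : ∀ a b, G.Adj a b → f a = f b := by
    intro a b h
    rcases lt_trichotomy a b with hab | hab | hab
    · exact h0 a b hab h
    · rw [hab]
    · exact (h0 b a hab h.symm).symm
  obtain ⟨p⟩ := hG.preconnected i j
  induction p with
  | nil => rfl
  | cons h _ ih => exact (h1 _ _ h).trans ih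

theorem degree_pos {G : SimpleGraph (Fin n)} [DecidableRel G.Adj] (hn : 2 ≤ n)
    (hG : G.Connected) (i : Fin n) : 0 < G.degree i := by
  have : Nontrivial (Fin n) := Fin.nontrivial_iff_two_le.2 hn
  exact hG.preconnected.degree_pos_of_nontrivial i

theorem isUnit_det_degMatrix {G : SimpleGraph (Fin n)} [DecidableRel G.Adj]
    (hd : ∀ i, 0 < G.degree i) : IsUnit (G.degMatrix ℝ).det := by
  rw [SimpleGraph.degMatrix, Matrix.det_diagonal, isUnit_iff_ne_zero]
  exact Finset.prod_ne_zero_iff.2 fun i _ => Nat.cast_ne_zero.2 (hd i).ne'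

theorem walkMatrix_mulVec_eq_smul_iff {G : SimpleGraph (Fin n)} [DecidableRel G.Adj]
    (hd : ∀ i, 0 < G.degree i) (h : Fin n → ℝ) (μ : ℝ) :
    (walkMatrix G).mulVec h = μ • h ↔
      ∀ i, (G.adjMatrix ℝ).mulVec h i = μ * (G.degree i * h i) := by
  have hu := isUnit_det_degMatrix hd
  have key : (walkMatrix G).mulVec h = μ • h ↔
      (G.adjMatrix ℝ).mulVec h = μ • (G.degMatrix ℝ).mulVec h := by
    constructor
    · intro H
      rw [← Matrix.mulVec_smul, ← H, walkMatrix, Matrix.mulVec_mulVec,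
        Matrix.mul_nonsing_inv_cancel_left _ _ hu]
    · intro H
      rw [walkMatrix, ← Matrix.mulVec_mulVec, H, Matrix.mulVec_smul, Matrix.mulVec_mulVec,
        Matrix.nonsing_inv_mul _ hu, Matrix.one_mulVec]
  rw [key, funext_iff]
  simp [SimpleGraph.degMatrix_mulVec_apply]

theorem hasEigenvalue_walkMatrix_iff {G : SimpleGraph (Fin n)} [DecidableRel G.Adj]
    (hd : ∀ i, 0 < G.degree i) (μ : ℝ) :
    Module.End.HasEigenvalue (Matrix.toLin' (walkMatrix G)) μ ↔
      ∃ h : Fin n → ℝ, h ≠ 0 ∧ ∀ i, (G.adjMatrix ℝ).mulVec h i = μ * (G.degree i * h i) := by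
  constructor
  · intro H
    obtain ⟨h, hh⟩ := H.exists_hasEigenvector
    refine ⟨h, hh.2, (walkMatrix_mulVec_eq_smul_iff hd h μ).1 ?_⟩
    simpa using hh.apply_eq_smul
  · rintro ⟨h, h0, hh⟩
    refine Module.End.hasEigenvalue_of_hasEigenvector (x := h)
      (Module.End.hasEigenvector_iff.2 ⟨Module.End.mem_eigenspace_iff.2 ?_, h0⟩)
    simpa using (walkMatrix_mulVec_eq_smul_iff hd h μ).2 hh

/-- Nonnegativity of the form then gives `μ ≤ 1`, and for `μ = 1` the form vanishes, so that on a
connected graph `h` is constant. -/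
theorem dirichletForm_eq_of_eigenvector {G : SimpleGraph (Fin n)} [DecidableRel G.Adj]
    {h : Fin n → ℝ} {μ : ℝ}
    (hh : ∀ i, (G.adjMatrix ℝ).mulVec h i = μ * (G.degree i * h i)) :
    dirichletForm G h = (1 - μ) * ∑ i, (G.degree i : ℝ) * h i ^ 2 := by
  rw [dirichletForm_eq, Finset.mul_sum, ← Finset.sum_sub_distrib]
  refine Finset.sum_congr rfl fun i _ => ?_
  rw [hh]
  ring

theorem sum_degree_mul_sq_pos {G : SimpleGraph (Fin n)} [DecidableRel G.Adj]
    (hd : ∀ i, 0 < G.degree i) {h : Fin n → ℝ} (h0 : h ≠ 0) :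
    0 < ∑ i, (G.degree i : ℝ) * h i ^ 2 := by
  obtain ⟨i, hi⟩ := Function.ne_iff.1 h0
  have hdi : (0 : ℝ) < G.degree i := Nat.cast_pos.2 (hd i)
  have : 0 < h i ^ 2 := by have : h i ≠ 0 := hi; positivity
  exact Finset.sum_pos' (fun j _ => by positivity) ⟨i, Finset.mem_univ _, by positivity⟩

/-- The symmetric normalization `D^(-1/2) B D^(-1/2)` of the transition matrix. -/
def symmWalkMatrix (G : SimpleGraph (Fin n)) [DecidableRel G.Adj] : Matrix (Fin n) (Fin n) ℝ :=
  Matrix.of fun i j => (√(G.degree i : ℝ))⁻¹ * G.adjMatrix ℝ i j * (√(G.degree j : ℝ))⁻¹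

theorem isHermitian_symmWalkMatrix (G : SimpleGraph (Fin n)) [DecidableRel G.Adj] :
    (symmWalkMatrix G).IsHermitian := by
  ext i j
  simp only [symmWalkMatrix, Matrix.conjTranspose_apply, Matrix.of_apply, star_trivial,
    SimpleGraph.adjMatrix_apply, G.adj_comm j i]
  ring

theorem symmWalkMatrix_mulVec (G : SimpleGraph (Fin n)) [DecidableRel G.Adj] (u : Fin n → ℝ)
    (i : Fin n) : (symmWalkMatrix G).mulVec u i = (√(G.degree i : ℝ))⁻¹ *
      (G.adjMatrix ℝ).mulVec (fun j => (√(G.degree j : ℝ))⁻¹ * u j) i := by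
  simp only [Matrix.mulVec, dotProduct, symmWalkMatrix, Matrix.of_apply, Finset.mul_sum]
  exact Finset.sum_congr rfl fun j _ => by ring

/-- The mean of `f` with respect to the stationary law of the random walk. -/
def degreeMean (G : SimpleGraph (Fin n)) [DecidableRel G.Adj] (f : Fin n → ℝ) : ℝ :=
  (∑ i, (G.degree i : ℝ) * f i) / ∑ i, (G.degree i : ℝ)

/-- Conjugation by `D^(1/2)` makes the walk symmetric, and both sides of the inequality become
diagonal in an orthonormal eigenbasis. Eigenvectors for `1` correspond to constants and are
orthogonal to centered functions; every other eigenvalue is at most `λ₂`. -/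
theorem spectralGap_walkMatrix_pos_and_poincare {G : SimpleGraph (Fin n)} [DecidableRel G.Adj]
    (hn : 2 ≤ n) (hG : G.Connected) :
    0 < spectralGap (walkMatrix G) ∧ ∀ f : Fin n → ℝ,
      spectralGap (walkMatrix G) * ∑ i, (G.degree i : ℝ) * (f i - degreeMean G f) ^ 2 ≤
        dirichletForm G f := by
  have hd := degree_pos hn hG
  have hd' : ∀ i, (0 : ℝ) < G.degree i := fun i => Nat.cast_pos.2 (hd i)
  have hs : ∀ i, 0 < √(G.degree i : ℝ) := fun i => Real.sqrt_pos.2 (hd' i)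
  have hss : ∀ i, √(G.degree i : ℝ) * √(G.degree i : ℝ) = G.degree i :=
    fun i => Real.mul_self_sqrt (hd' i).le
  set T := {μ : ℝ | Module.End.HasEigenvalue (Matrix.toLin' (walkMatrix G)) μ ∧ μ ≠ 1} with hT
  have hTfin : T.Finite :=
    (Module.End.finite_hasEigenvalue (Matrix.toLin' (walkMatrix G))).subset fun _ h => h.1
  have hTlt : ∀ μ ∈ T, μ < 1 := by
    rintro μ ⟨h1, h2⟩
    obtain ⟨h, h0, hh⟩ := (hasEigenvalue_walkMatrix_iff hd μ).1 h1
    have := dirichletForm_eq_of_eigenvector hh ▸ dirichletForm_nonneg G h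
    have := nonneg_of_mul_nonneg_left this (sum_degree_mul_sq_pos hd h0)
    exact lt_of_le_of_ne (by linarith) h2
  have hN := isHermitian_symmWalkMatrix G
  set u := hN.eigenvectorBasis with hu
  set ev := hN.eigenvalues with hev
  have heig : ∀ a i, (G.adjMatrix ℝ).mulVec (fun j => (√(G.degree j : ℝ))⁻¹ * u a j) i =
      ev a * (G.degree i * ((√(G.degree i : ℝ))⁻¹ * u a i)) := by
    intro a i
    have h1 := congrFun (hN.mulVec_eigenvectorBasis a) i
    rw [symmWalkMatrix_mulVec, inv_mul_eq_iff_eq_mul₀ (hs i).ne'] at h1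
    rw [h1, Pi.smul_apply, smul_eq_mul]
    nth_rw 2 [← hss i]
    field_simp [(hs i).ne']
    rfl
  have hne : ∀ a, (fun j => (√(G.degree j : ℝ))⁻¹ * u a j) ≠ 0 := by
    intro a h
    apply u.orthonormal.ne_zero a
    ext j
    have := congrFun h j
    simpa [(hs j).ne'] using this
  have hmem : ∀ a, ev a ≠ 1 → ev a ∈ T := fun a ha =>
    ⟨(hasEigenvalue_walkMatrix_iff hd _).2 ⟨_, hne a, heig a⟩, ha⟩
  -- Without loops the trace is `0`, whereas it would be `n` if all eigenvalues were `1`. Hence the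
  -- `sSup` is attained and is not the default value on the empty set.
  have hTne : T.Nonempty := by
    by_contra hcon
    have hall : ∀ a, ev a = 1 := fun a => by
      by_contra ha
      exact hcon ⟨_, hmem a ha⟩
    have htr := hN.trace_eq_sum_eigenvalues
    have h0 : (symmWalkMatrix G).trace = 0 := by
      simp [Matrix.trace, symmWalkMatrix]
    rw [h0] at htr
    have : ∑ i, hN.eigenvalues i = n := by simp [← hev, hall]
    simp only [RCLike.ofReal_real_eq_id, id] at htr
    rw [this] at htr
    have : (n : ℝ) ≠ 0 := by positivity
    exact this htr.symm
  have hgap : 0 < spectralGap (walkMatrix G) := by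
    have := hTlt _ (hTne.csSup_mem hTfin)
    rw [spectralGap]; linarith
  refine ⟨hgap, fun f => ?_⟩
  set c := degreeMean G f with hc
  -- The weight `√(degree)` turns the degree-weighted norm into the Euclidean one.
  set y : EuclideanSpace ℝ (Fin n) :=
    WithLp.toLp 2 (fun i => √(G.degree i : ℝ) * (f i - c)) with hy
  have hvol : ∑ i, (G.degree i : ℝ) ≠ 0 := by
    have : Nonempty (Fin n) := ⟨⟨0, by omega⟩⟩
    exact (Finset.sum_pos (fun i _ => hd' i) Finset.univ_nonempty).ne'
  have hcen : ∑ i, (G.degree i : ℝ) * (f i - c) = 0 := by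
    simp_rw [mul_sub, Finset.sum_sub_distrib, ← Finset.sum_mul]
    rw [hc, degreeMean]
    field_simp
    ring
  have hnorm : ∑ i, (G.degree i : ℝ) * (f i - c) ^ 2 = ∑ a, inner ℝ (u a) y ^ 2 := by
    have h1 := u.sum_inner_mul_inner y y
    rw [PiLp.inner_apply] at h1
    have h2 : ∑ i, (G.degree i : ℝ) * (f i - c) ^ 2 = ∑ i, inner ℝ (y i) (y i) := by
      refine Finset.sum_congr rfl fun i _ => ?_
      simp only [hy, RCLike.inner_apply, conj_trivial]
      linear_combination -(f i - c) ^ 2 * hss i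
    rw [h2, ← h1]
    refine Finset.sum_congr rfl fun a _ => ?_
    rw [real_inner_comm]; ring
  have hinner : ∀ a, inner ℝ (u a) y = ∑ i, u a i * (√(G.degree i : ℝ) * (f i - c)) := by
    intro a
    simp only [PiLp.inner_apply, hy, RCLike.inner_apply, conj_trivial]
    exact Finset.sum_congr rfl fun i _ => mul_comm _ _
  set z : EuclideanSpace ℝ (Fin n) := WithLp.toLp 2 ((symmWalkMatrix G).mulVec y.ofLp) with hz
  have hzin : ∀ a, inner ℝ (u a) z = ev a * inner ℝ (u a) y := by
    intro a
    have h1 : inner ℝ (u a) z = (u a).ofLp ⬝ᵥ (symmWalkMatrix G).mulVec y.ofLp := by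
      simp only [PiLp.inner_apply, hz, RCLike.inner_apply, conj_trivial, dotProduct]
      exact Finset.sum_congr rfl fun i _ => mul_comm _ _
    have h2 : inner ℝ (u a) y = (u a).ofLp ⬝ᵥ y.ofLp := by
      simp only [PiLp.inner_apply, RCLike.inner_apply, conj_trivial, dotProduct]
      exact Finset.sum_congr rfl fun i _ => mul_comm _ _
    have h3 : (symmWalkMatrix G).transpose = symmWalkMatrix G := by
      rw [← Matrix.conjTranspose_eq_transpose_of_trivial, hN.eq]
    rw [h1, h2, Matrix.dotProduct_mulVec, ← Matrix.mulVec_transpose, h3,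
      hN.mulVec_eigenvectorBasis, smul_dotProduct, smul_eq_mul]
  have hdir : dirichletForm G f = ∑ a, (1 - ev a) * inner ℝ (u a) y ^ 2 := by
    have hshift : dirichletForm G f = dirichletForm G (fun i => f i - c) := by
      simp [dirichletForm]
    have h1 := u.sum_inner_mul_inner y z
    rw [PiLp.inner_apply] at h1
    have h2 : ∑ i, (f i - c) * (G.adjMatrix ℝ).mulVec (fun i => f i - c) i =
        ∑ a, ev a * inner ℝ (u a) y ^ 2 := by
      have h3 : ∑ i, (f i - c) * (G.adjMatrix ℝ).mulVec (fun i => f i - c) i =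
          ∑ i, inner ℝ (y i) (z i) := by
        refine Finset.sum_congr rfl fun i _ => ?_
        have h4 : (fun j => (√(G.degree j : ℝ))⁻¹ * (√(G.degree j : ℝ) * (f j - c))) =
            fun j => f j - c := by
          funext j
          rw [inv_mul_cancel_left₀ (hs j).ne']
        simp only [hy, hz, RCLike.inner_apply, conj_trivial, symmWalkMatrix_mulVec, h4]
        field_simp [(hs i).ne']
      rw [h3, ← h1]
      refine Finset.sum_congr rfl fun a _ => ?_
      rw [hzin, real_inner_comm]; ring
    rw [hshift, dirichletForm_eq, h2, hnorm, ← Finset.sum_sub_distrib]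
    exact Finset.sum_congr rfl fun a _ => by ring
  rw [hdir, hnorm, Finset.mul_sum]
  refine Finset.sum_le_sum fun a _ => ?_
  by_cases ha : ev a = 1
  · have h0 : dirichletForm G (fun j => (√(G.degree j : ℝ))⁻¹ * u a j) = 0 := by
      rw [dirichletForm_eq_of_eigenvector (heig a), ha]; simp
    have hconst := eq_of_dirichletForm_eq_zero hG h0
    have : inner ℝ (u a) y = 0 := by
      rw [hinner]
      let i₀ : Fin n := ⟨0, by omega⟩
      have : ∀ i, u a i * (√(G.degree i : ℝ) * (f i - c)) =
          ((√(G.degree i₀ : ℝ))⁻¹ * u a i₀) * ((G.degree i : ℝ) * (f i - c)) := by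
        intro i
        rw [← hconst i i₀]
        nth_rw 3 [← hss i]
        field_simp [(hs i).ne']
      simp_rw [this, ← Finset.mul_sum, hcen, mul_zero]
    simp [this]
  · have := le_csSup hTfin.bddAbove (hmem a ha)
    refine mul_le_mul_of_nonneg_right ?_ (sq_nonneg _)
    rw [spectralGap]; linarith

/-! ### Concentration of the score at the true weights -/

theorem prefProb_nonneg {w : Fin n → ℝ} (hw : ∀ i, 0 < w i) (i j : Fin n) :
    0 ≤ prefProb w i j := by
  have := hw i; have := hw j
  unfold prefProb; positivity

theorem prefProb_add_prefProb {w : Fin n → ℝ} (hw : ∀ i, 0 < w i) (i j : Fin n) :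
    prefProb w i j + prefProb w j i = 1 := by
  have := hw i; have := hw j
  unfold prefProb
  field_simp
  ring

theorem isProbabilityMeasure_comparisonLaw {w : Fin n → ℝ} (hw : ∀ i, 0 < w i) (i j : Fin n) :
    IsProbabilityMeasure (comparisonLaw w i j) := by
  constructor
  simp only [comparisonLaw, Measure.add_apply, Measure.smul_apply, measure_univ, smul_eq_mul,
    mul_one]
  rw [← ENNReal.ofReal_add (prefProb_nonneg hw i j) (prefProb_nonneg hw j i),
    prefProb_add_prefProb hw, ENNReal.ofReal_one]

/-- The outcome of one comparison, centered at its expectation `p`. -/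
def centeredOutcome (p : ℝ) (y : Bool) : ℝ :=
  (if y = true then 1 else 0) - p

theorem integral_centeredOutcome {w : Fin n → ℝ} (hw : ∀ i, 0 < w i) (i j : Fin n) :
    ∫ y, centeredOutcome (prefProb w i j) y ∂comparisonLaw w i j = 0 := by
  have h1 : IsFiniteMeasure (ENNReal.ofReal (prefProb w i j) • Measure.dirac true) :=
    Measure.smul_finite _ ENNReal.ofReal_ne_top
  have h2 : IsFiniteMeasure (ENNReal.ofReal (prefProb w j i) • Measure.dirac false) :=
    Measure.smul_finite _ ENNReal.ofReal_ne_top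
  rw [comparisonLaw, integral_add_measure Integrable.of_finite Integrable.of_finite,
    integral_smul_measure, integral_smul_measure, integral_dirac, integral_dirac,
    ENNReal.toReal_ofReal (prefProb_nonneg hw i j), ENNReal.toReal_ofReal (prefProb_nonneg hw j i)]
  have h := prefProb_add_prefProb hw i j
  simp only [centeredOutcome, smul_eq_mul, if_true, Bool.false_eq_true, if_false]
  linear_combination -(prefProb w i j) * h

/-- Hoeffding's lemma: the values lie in an interval of length 1. -/
theorem hasSubgaussianMGF_centeredOutcome {w : Fin n → ℝ} (hw : ∀ i, 0 < w i) (i j : Fin n) :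
    ProbabilityTheory.HasSubgaussianMGF (centeredOutcome (prefProb w i j)) (1 / 4)
      (comparisonLaw w i j) := by
  have := isProbabilityMeasure_comparisonLaw hw i j
  have h := ProbabilityTheory.hasSubgaussianMGF_of_mem_Icc_of_integral_eq_zero
    (μ := comparisonLaw w i j) (X := centeredOutcome (prefProb w i j))
    (a := -prefProb w i j) (b := 1 - prefProb w i j)
    (measurable_of_finite _).aemeasurable (ae_of_all _ fun y => by
      cases y <;> simp [centeredOutcome]) (integral_centeredOutcome hw i j)
  convert h using 1
  simp only [sub_neg_eq_add, sub_add_cancel]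
  ext
  norm_num

/-- The signed incidence of `i` with a compared pair. -/
def incidence {G : SimpleGraph (Fin n)} (e : ComparedPair G) (i : Fin n) : ℝ :=
  (if e.1.1 = i then 1 else 0) - (if e.1.2 = i then 1 else 0)

theorem sum_mul_incidence {G : SimpleGraph (Fin n)} (e : ComparedPair G) (f : Fin n → ℝ) :
    ∑ i, f i * incidence e i = f e.1.1 - f e.1.2 := by
  simp [incidence, mul_sub, Finset.sum_sub_distrib]

theorem sum_incidence_sq (G : SimpleGraph (Fin n)) [DecidableRel G.Adj] (i : Fin n) :
    ∑ e : ComparedPair G, incidence e i ^ 2 = G.degree i := by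
  have h1 := sum_adj_eq_sum_comparedPair G (fun a _ => if a = i then 1 else 0)
  have h2 : ∑ a, ∑ j, (if G.Adj a j then (if a = i then (1 : ℝ) else 0) else 0) = G.degree i := by
    rw [Finset.sum_eq_single i (fun a _ ha => by simp [ha]) (by simp),
      SimpleGraph.degree_eq_sum_if_adj]
    simp
  rw [← h2, h1]
  refine Finset.sum_congr rfl fun e _ => ?_
  have := e.2.1.ne
  unfold incidence
  by_cases h : e.1.1 = i
  · have : e.1.2 ≠ i := fun h' => this (h.trans h'.symm)
    simp [h, this]
  · by_cases h' : e.1.2 = i <;> simp [h, h']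

/-- The components of the score, that is of the gradient of the log-likelihood with respect to
the logarithms of the weights `w`. -/
def score (G : SimpleGraph (Fin n)) [DecidableRel G.Adj] {k : ℕ} (w : Fin n → ℝ)
    (x : Outcomes G k) (i : Fin n) : ℝ :=
  ∑ c : ComparedPair G × Fin k,
    incidence c.1 i * centeredOutcome (prefProb w c.1.1.1 c.1.1.2) (x c)

theorem sum_mul_score (G : SimpleGraph (Fin n)) [DecidableRel G.Adj] {k : ℕ} (w : Fin n → ℝ)
    (x : Outcomes G k) (f : Fin n → ℝ) :
    ∑ i, f i * score G w x i = ∑ c : ComparedPair G × Fin k,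
      centeredOutcome (prefProb w c.1.1.1 c.1.1.2) (x c) * (f c.1.1.1 - f c.1.1.2) := by
  simp_rw [score, Finset.mul_sum]
  rw [Finset.sum_comm]
  refine Finset.sum_congr rfl fun c _ => ?_
  rw [← sum_mul_incidence, Finset.mul_sum]
  exact Finset.sum_congr rfl fun i _ => by ring

theorem isProbabilityMeasure_outcomeLaw (G : SimpleGraph (Fin n)) [DecidableRel G.Adj] (k : ℕ)
    {w : Fin n → ℝ} (hw : ∀ i, 0 < w i) : IsProbabilityMeasure (outcomeLaw G k w) := by
  have := fun c : ComparedPair G × Fin k =>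
    isProbabilityMeasure_comparisonLaw hw c.1.1.1 c.1.1.2
  unfold outcomeLaw
  infer_instance

/-- Only the `k * G.degree i` comparisons involving `i` contribute, each with variance proxy `1 /
4`. The sign `s = ±1` serves both tails. -/
theorem measureReal_le_mul_score (G : SimpleGraph (Fin n)) [DecidableRel G.Adj] (k : ℕ)
    {w : Fin n → ℝ} (hw : ∀ i, 0 < w i) (i : Fin n) {s : ℝ} (hs : s ^ 2 = 1) {t : ℝ}
    (ht : 0 ≤ t) :
    (outcomeLaw G k w).real {x | t ≤ s * score G w x i} ≤
      Real.exp (-2 * t ^ 2 / (k * G.degree i)) := by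
  have := fun c : ComparedPair G × Fin k =>
    isProbabilityMeasure_comparisonLaw hw c.1.1.1 c.1.1.2
  let X : (c : ComparedPair G × Fin k) → Bool → ℝ := fun c y =>
    (s * incidence c.1 i) * centeredOutcome (prefProb w c.1.1.1 c.1.1.2) y
  have hind : ProbabilityTheory.iIndepFun (fun c (x : Outcomes G k) => X c (x c))
      (outcomeLaw G k w) :=
    ProbabilityTheory.iIndepFun_pi (X := X) fun c => (measurable_of_finite _).aemeasurable
  have hsub : ∀ c ∈ (Finset.univ : Finset (ComparedPair G × Fin k)),
      ProbabilityTheory.HasSubgaussianMGF (fun x : Outcomes G k => X c (x c))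
        (Real.toNNReal ((s * incidence c.1 i) ^ 2) * (1 / 4)) (outcomeLaw G k w) := by
    intro c _
    have h1 := (hasSubgaussianMGF_centeredOutcome hw c.1.1.1 c.1.1.2).const_mul
      (s * incidence c.1 i)
    refine ProbabilityTheory.HasSubgaussianMGF.of_map (Y := fun x : Outcomes G k => x c)
      (X := X c) (measurable_pi_apply c).aemeasurable ?_
    have h2 : (outcomeLaw G k w).map (fun x => x c) = comparisonLaw w c.1.1.1 c.1.1.2 :=
      (measurePreserving_eval (fun c : ComparedPair G × Fin k =>
        comparisonLaw w c.1.1.1 c.1.1.2) c).map_eq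
    rw [h2, Real.toNNReal_of_nonneg (sq_nonneg _)]
    exact h1
  have h := ProbabilityTheory.HasSubgaussianMGF.measure_sum_ge_le_of_iIndepFun hind hsub ht
  have hsum : ∀ x : Outcomes G k, ∑ c, X c (x c) = s * score G w x i := by
    intro x
    rw [score, Finset.mul_sum]
    exact Finset.sum_congr rfl fun c _ => by ring
  simp_rw [hsum] at h
  refine h.trans (le_of_eq ?_)
  congr 1
  have h3 : ((∑ c : ComparedPair G × Fin k,
      Real.toNNReal ((s * incidence c.1 i) ^ 2) * (1 / 4) : NNReal) : ℝ) =
      k * G.degree i / 4 := by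
    rw [NNReal.coe_sum]
    have : ∀ c : ComparedPair G × Fin k,
        ((Real.toNNReal ((s * incidence c.1 i) ^ 2) * (1 / 4) : NNReal) : ℝ) =
          incidence c.1 i ^ 2 / 4 := by
      intro c
      rw [NNReal.coe_mul, Real.coe_toNNReal _ (sq_nonneg _), mul_pow, hs]
      push_cast
      ring
    simp_rw [this]
    rw [Fintype.sum_prod_type]
    simp only [Finset.sum_const, Finset.card_univ, Fintype.card_fin, nsmul_eq_mul]
    rw [← Finset.mul_sum, ← Finset.sum_div, sum_incidence_sq]
    ring
  rw [h3, show (2 * (k * G.degree i / 4 : ℝ)) = (k * G.degree i) / 2 by ring, div_div_eq_mul_div]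
  ring

/-- At this threshold the Hoeffding exponent is at most `-2 * log n`; the union is over `n` items
and two signs. -/
theorem measureReal_exists_lt_abs_score_le {G : SimpleGraph (Fin n)} [DecidableRel G.Adj]
    (hn : 2 ≤ n) (hG : G.Connected) {k : ℕ} (hk : 0 < k) {w : Fin n → ℝ} (hw : ∀ i, 0 < w i) :
    (outcomeLaw G k w).real
      {x | ∃ i, √(k * G.maxDegree * Real.log n) < |score G w x i|} ≤ 2 / n := by
  have := isProbabilityMeasure_outcomeLaw G k hw
  set t := √(k * G.maxDegree * Real.log n) with ht
  have hn0 : (0 : ℝ) < n := by positivity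
  have hlog : 0 ≤ Real.log n := Real.log_natCast_nonneg n
  have hone : ∀ i, ∀ s : ℝ, s ^ 2 = 1 →
      (outcomeLaw G k w).real {x | t ≤ s * score G w x i} ≤ 1 / (n : ℝ) ^ 2 := by
    intro i s hs
    refine (measureReal_le_mul_score G k hw i hs (Real.sqrt_nonneg _)).trans ?_
    have hd : (0 : ℝ) < k * G.degree i :=
      mul_pos (Nat.cast_pos.2 hk) (Nat.cast_pos.2 (degree_pos hn hG i))
    have h1 : -2 * t ^ 2 / (k * G.degree i) ≤ -(2 * Real.log n) := by
      rw [div_le_iff₀ hd, ht, Real.sq_sqrt (by positivity)]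
      have h2 : (G.degree i : ℝ) ≤ G.maxDegree := Nat.cast_le.2 (G.degree_le_maxDegree i)
      have h3 : (k : ℝ) * G.degree i * Real.log n ≤ k * G.maxDegree * Real.log n := by gcongr
      linarith
    refine (Real.exp_le_exp.2 h1).trans (le_of_eq ?_)
    rw [Real.exp_neg, two_mul, Real.exp_add, Real.exp_log hn0, one_div, sq]
  have hsub : {x : Outcomes G k | ∃ i, t < |score G w x i|} ⊆
      ⋃ i, ({x | t ≤ 1 * score G w x i} ∪ {x | t ≤ -1 * score G w x i}) := by
    rintro x ⟨i, hi⟩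
    refine Set.mem_iUnion.2 ⟨i, ?_⟩
    rcases lt_abs.1 hi with h | h
    · left; simpa using h.le
    · right; simpa using h.le
  calc (outcomeLaw G k w).real {x | ∃ i, t < |score G w x i|}
      ≤ (outcomeLaw G k w).real
          (⋃ i, ({x | t ≤ 1 * score G w x i} ∪ {x | t ≤ -1 * score G w x i})) :=
        measureReal_mono hsub
    _ ≤ ∑ i, (outcomeLaw G k w).real
          ({x | t ≤ 1 * score G w x i} ∪ {x | t ≤ -1 * score G w x i}) :=
        measureReal_iUnion_fintype_le _
    _ ≤ ∑ _i : Fin n, 2 / (n : ℝ) ^ 2 := by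
        refine Finset.sum_le_sum fun i _ => (measureReal_union_le _ _).trans ?_
        have h1 := hone i 1 (by norm_num)
        have h2 := hone i (-1) (by norm_num)
        calc _ ≤ 1 / (n : ℝ) ^ 2 + 1 / (n : ℝ) ^ 2 := add_le_add h1 h2
          _ = _ := by ring
    _ = 2 / n := by
        simp only [Finset.sum_const, Finset.card_univ, Fintype.card_fin, nsmul_eq_mul]
        field_simp

/-! ### Likelihood equations and existence of a maximizer -/

theorem prefProb_pos {w : Fin n → ℝ} (hw : ∀ i, 0 < w i) (i j : Fin n) : 0 < prefProb w i j := by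
  have := hw i; have := hw j
  unfold prefProb; positivity

theorem prefProb_le_one {w : Fin n → ℝ} (hw : ∀ i, 0 < w i) (i j : Fin n) :
    prefProb w i j ≤ 1 := by
  have := prefProb_add_prefProb hw i j
  have := prefProb_nonneg hw j i
  linarith

theorem prefProb_smul {a : ℝ} (ha : a ≠ 0) (w : Fin n → ℝ) (i j : Fin n) :
    prefProb (a • w) i j = prefProb w i j := by
  simp only [prefProb, Pi.smul_apply, smul_eq_mul]
  rw [← mul_add, mul_div_mul_left _ _ ha]

theorem likelihood_smul (G : SimpleGraph (Fin n)) [DecidableRel G.Adj] {k : ℕ} (x : Outcomes G k)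
    {a : ℝ} (ha : a ≠ 0) (v : Fin n → ℝ) : likelihood G x (a • v) = likelihood G x v := by
  simp only [likelihood, prefProb_smul ha]

theorem likelihood_pos (G : SimpleGraph (Fin n)) [DecidableRel G.Adj] {k : ℕ} (x : Outcomes G k)
    {v : Fin n → ℝ} (hv : ∀ i, 0 < v i) : 0 < likelihood G x v := by
  refine Finset.prod_pos fun c _ => ?_
  split_ifs <;> exact prefProb_pos hv _ _

theorem hasDerivAt_log_prefProb {v : Fin n → ℝ} (hv : ∀ i, 0 < v i) (f : Fin n → ℝ)
    (i j : Fin n) :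
    HasDerivAt (fun t : ℝ => Real.log (prefProb (fun l => v l * Real.exp (t * f l)) i j))
      ((1 - prefProb v i j) * (f i - f j)) 0 := by
  have hi := hv i
  have hj := hv j
  have hd : ∀ l, HasDerivAt (fun t : ℝ => v l * Real.exp (t * f l)) (v l * f l) 0 := by
    intro l
    have := (((hasDerivAt_id (0 : ℝ)).mul_const (f l)).exp).const_mul (v l)
    simpa using this
  have h1 : HasDerivAt (fun t : ℝ => Real.log (v i * Real.exp (t * f i)) -
      Real.log (v i * Real.exp (t * f i) + v j * Real.exp (t * f j)))
      (v i * f i / v i - (v i * f i + v j * f j) / (v i + v j)) 0 := by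
    have h2 := ((hd i).log (by simpa using hi.ne')).fun_sub
      (((hd i).fun_add (hd j)).log (by simpa using (add_pos hi hj).ne'))
    simpa using h2
  have h3 : (fun t : ℝ => Real.log (prefProb (fun l => v l * Real.exp (t * f l)) i j)) =
      fun t : ℝ => Real.log (v i * Real.exp (t * f i)) -
        Real.log (v i * Real.exp (t * f i) + v j * Real.exp (t * f j)) := by
    funext t
    rw [prefProb, Real.log_div (by positivity) (by positivity)]
  rw [h3]
  convert h1 using 1
  unfold prefProb
  field_simp
  ring

/-- The likelihood equations. -/
theorem sum_mul_score_eq_zero {G : SimpleGraph (Fin n)} [DecidableRel G.Adj] {k : ℕ}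
    {x : Outcomes G k} {v : Fin n → ℝ} (hv : IsMLEstimate G x v) (f : Fin n → ℝ) :
    ∑ i, f i * score G v x i = 0 := by
  have hpos : ∀ t : ℝ, ∀ l, 0 < v l * Real.exp (t * f l) := fun t l =>
    mul_pos (hv.1 l) (Real.exp_pos _)
  have hmax : IsLocalMax
      (fun t : ℝ => Real.log (likelihood G x (fun l => v l * Real.exp (t * f l)))) 0 := by
    refine Filter.Eventually.of_forall fun t => ?_
    refine Real.log_le_log (likelihood_pos G x (hpos t)) ?_
    simpa using hv.2 _ (hpos t)
  have hder : HasDerivAt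
      (fun t : ℝ => Real.log (likelihood G x (fun l => v l * Real.exp (t * f l))))
      (∑ c : ComparedPair G × Fin k,
        centeredOutcome (prefProb v c.1.1.1 c.1.1.2) (x c) * (f c.1.1.1 - f c.1.1.2)) 0 := by
    have h1 : (fun t : ℝ => Real.log (likelihood G x (fun l => v l * Real.exp (t * f l)))) =
        fun t : ℝ => ∑ c : ComparedPair G × Fin k, Real.log (if x c = true
          then prefProb (fun l => v l * Real.exp (t * f l)) c.1.1.1 c.1.1.2
          else prefProb (fun l => v l * Real.exp (t * f l)) c.1.1.2 c.1.1.1) := by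
      funext t
      refine Real.log_prod fun c _ => ?_
      split_ifs <;> exact (prefProb_pos (hpos t) _ _).ne'
    rw [h1]
    refine HasDerivAt.fun_sum fun c _ => ?_
    rcases Bool.eq_false_or_eq_true (x c) with hx | hx
    · rw [hx]
      simpa [centeredOutcome] using hasDerivAt_log_prefProb hv.1 f c.1.1.1 c.1.1.2
    · rw [hx]
      have h2 := hasDerivAt_log_prefProb hv.1 f c.1.1.2 c.1.1.1
      have h3 := prefProb_add_prefProb hv.1 c.1.1.1 c.1.1.2
      have h4 : centeredOutcome (prefProb v c.1.1.1 c.1.1.2) false * (f c.1.1.1 - f c.1.1.2) =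
          (1 - prefProb v c.1.1.2 c.1.1.1) * (f c.1.1.2 - f c.1.1.1) := by
        simp only [centeredOutcome, Bool.false_eq_true, if_false]
        linear_combination (f c.1.1.2 - f c.1.1.1) * h3
      rw [h4]
      exact h2
  rw [sum_mul_score]
  exact hmax.hasDerivAt_eq_zero hder

/-- `i` was preferred to `j` in one of the comparisons. -/
def Beats {G : SimpleGraph (Fin n)} {k : ℕ} (x : Outcomes G k) (i j : Fin n) : Prop :=
  ∃ c, (x c = true ∧ c.1.1.1 = i ∧ c.1.1.2 = j) ∨ (x c = false ∧ c.1.1.2 = i ∧ c.1.1.1 = j)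

theorem likelihood_le_prefProb {G : SimpleGraph (Fin n)} [DecidableRel G.Adj] {k : ℕ}
    {x : Outcomes G k} {v : Fin n → ℝ} (hv : ∀ i, 0 < v i) {i j : Fin n} (h : Beats x i j) :
    likelihood G x v ≤ prefProb v i j := by
  obtain ⟨c, hc⟩ := h
  have h1 : likelihood G x v ≤
      if x c = true then prefProb v c.1.1.1 c.1.1.2 else prefProb v c.1.1.2 c.1.1.1 := by
    rw [likelihood, ← Finset.mul_prod_erase _ _ (Finset.mem_univ c)]
    refine mul_le_of_le_one_right ?_ (Finset.prod_le_one ?_ ?_)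
    · split_ifs <;> exact prefProb_nonneg hv _ _
    · intro d _
      split_ifs <;> exact prefProb_nonneg hv _ _
    · intro d _
      split_ifs <;> exact prefProb_le_one hv _ _
  rcases hc with ⟨hx, rfl, rfl⟩ | ⟨hx, rfl, rfl⟩
  · simpa [hx] using h1
  · simpa [hx] using h1

/-- One win of `l` over `j` forces `a ≤ prefProb v l j`, hence `v j ≤ v l / a`; these bounds
multiply along a chain of wins. On a superlevel set of the likelihood all ratios of weights are
therefore bounded. -/
theorem exists_bound_of_reflTransGen {G : SimpleGraph (Fin n)} [DecidableRel G.Adj] {k : ℕ}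
    {x : Outcomes G k} {a : ℝ} (ha : 0 < a) {i j : Fin n}
    (h : Relation.ReflTransGen (Beats x) i j) :
    ∃ K : ℝ, 0 ≤ K ∧ ∀ v : Fin n → ℝ, (∀ i, 0 < v i) → a ≤ likelihood G x v → v j ≤ K * v i := by
  induction h with
  | refl => exact ⟨1, zero_le_one, fun v _ _ => by simp⟩
  | @tail l j _ hlj ih =>
    obtain ⟨K, hK0, hK⟩ := ih
    refine ⟨a⁻¹ * K, by positivity, fun v hv hav => ?_⟩
    have h1 := hav.trans (likelihood_le_prefProb hv hlj)
    have h2 := hK v hv hav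
    have hl := hv l
    have hj := hv j
    rw [prefProb, le_div_iff₀ (by positivity)] at h1
    rw [mul_assoc, ← div_eq_inv_mul, le_div_iff₀ ha]
    nlinarith

theorem continuousOn_likelihood (G : SimpleGraph (Fin n)) [DecidableRel G.Adj] {k : ℕ}
    (x : Outcomes G k) : ContinuousOn (likelihood G x) {v | ∀ i, 0 < v i} := by
  have h : ∀ i j : Fin n, ContinuousOn (fun v => prefProb v i j) {v | ∀ i, 0 < v i} := by
    intro i j
    refine ContinuousOn.div (by fun_prop) (by fun_prop) fun v hv => ?_
    exact (add_pos (hv i) (hv j)).ne'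
  refine continuousOn_finsetProd _ fun c _ => ?_
  split_ifs <;> exact h _ _

/-- A maximum likelihood estimate exists if no proper set of items wins none of its
comparisons with the other items. -/
theorem exists_isMLEstimate_sum_eq {G : SimpleGraph (Fin n)} [DecidableRel G.Adj] {k : ℕ}
    {x : Outcomes G k} (hn : 0 < n)
    (hx : ∀ S : Set (Fin n), S.Nonempty → Sᶜ.Nonempty → ∃ i ∈ S, ∃ j ∈ Sᶜ, Beats x i j)
    {s : ℝ} (hs : 0 < s) : ∃ v, IsMLEstimate G x v ∧ ∑ i, v i = s := by
  have hne : Nonempty (Fin n) := ⟨⟨0, hn⟩⟩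
  have hreach : ∀ i j, Relation.ReflTransGen (Beats x) i j := by
    intro i
    by_contra! hcon
    obtain ⟨l, hl⟩ := hcon
    obtain ⟨p, hp, q, hq, hpq⟩ := hx {j | Relation.ReflTransGen (Beats x) i j}
      ⟨i, Relation.ReflTransGen.refl⟩ ⟨l, hl⟩
    exact hq (Relation.ReflTransGen.tail hp hpq)
  have ha := likelihood_pos G x (v := fun _ => 1) (fun _ => one_pos)
  -- The level is the likelihood of the constant vector: weights below it cannot compete, and
  -- weights above it have bounded ratios.
  choose K hK0 hK using fun i j => exists_bound_of_reflTransGen ha (hreach i j)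
  set M : ℝ := 1 + ∑ i, ∑ j, K i j with hM
  have hKM : ∀ i j, K i j ≤ M := by
    intro i j
    have h1 : K i j ≤ ∑ j, K i j :=
      Finset.single_le_sum (fun j _ => hK0 i j) (Finset.mem_univ j)
    have h2 : ∑ j, K i j ≤ ∑ i, ∑ j, K i j :=
      Finset.single_le_sum (f := fun i => ∑ j, K i j)
        (fun i _ => Finset.sum_nonneg fun j _ => hK0 i j) (Finset.mem_univ i)
    linarith
  have hM1 : 1 ≤ M := by
    have : 0 ≤ ∑ i, ∑ j, K i j := Finset.sum_nonneg fun i _ => Finset.sum_nonneg fun j _ => hK0 i j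
    linarith
  -- Weak inequalities keep `A` closed; one zero coordinate would make all coordinates zero,
  -- contradicting the positive sum.
  let A : Set (Fin n → ℝ) := {v | (∀ i, 0 ≤ v i) ∧ (∀ i j, v j ≤ M * v i) ∧ ∑ i, v i = s}
  have hApos : ∀ v ∈ A, ∀ i, 0 < v i := by
    rintro v ⟨h0, h1, h2⟩ i
    refine (h0 i).lt_of_ne fun hi => hs.ne ?_
    rw [← h2]
    refine (Finset.sum_eq_zero fun j _ => le_antisymm ?_ (h0 j)).symm
    simpa [← hi] using h1 i j
  have hAcomp : IsCompact A := by
    refine (isCompact_Icc (a := (0 : Fin n → ℝ)) (b := fun _ => s)).of_isClosed_subset ?_ ?_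
    · refine IsClosed.inter ?_ (IsClosed.inter ?_ ?_)
      · have : IsClosed {v : Fin n → ℝ | ∀ i, 0 ≤ v i} := by
          simp only [Set.ofPred_forall]
          exact isClosed_iInter fun i => isClosed_le continuous_const (continuous_apply i)
        exact this
      · have : IsClosed {v : Fin n → ℝ | ∀ i j, v j ≤ M * v i} := by
          simp only [Set.ofPred_forall]
          exact isClosed_iInter fun i => isClosed_iInter fun j =>
            isClosed_le (continuous_apply j) (by fun_prop)
        exact this
      · exact isClosed_eq (f := fun v : Fin n → ℝ => ∑ i, v i) (by fun_prop) continuous_const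
    · rintro v ⟨h0, -, h2⟩
      refine ⟨h0, fun i => ?_⟩
      rw [← h2]
      exact Finset.single_le_sum (fun j _ => h0 j) (Finset.mem_univ i)
  have hn' : (0 : ℝ) < n := Nat.cast_pos.2 hn
  have hAne : ((s / n) • fun _ => (1 : ℝ)) ∈ A := by
    refine ⟨fun i => ?_, fun i j => ?_, ?_⟩
    · simp only [Pi.smul_apply, smul_eq_mul]; positivity
    · simp only [Pi.smul_apply, smul_eq_mul, mul_one]
      exact le_mul_of_one_le_left (by positivity) hM1
    · simp only [Pi.smul_apply, smul_eq_mul, mul_one, Finset.sum_const, Finset.card_univ,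
        Fintype.card_fin, nsmul_eq_mul]
      field_simp
  obtain ⟨v, hvA, hv⟩ := hAcomp.exists_isMaxOn ⟨_, hAne⟩
    ((continuousOn_likelihood G x).mono hApos)
  refine ⟨v, ⟨hApos v hvA, fun u hu => ?_⟩, hvA.2.2⟩
  by_cases hcase : likelihood G x (fun _ => 1) ≤ likelihood G x u
  · have hsum : 0 < ∑ i, u i := Finset.sum_pos (fun i _ => hu i) Finset.univ_nonempty
    have hc : 0 < s / ∑ i, u i := by positivity
    rw [← likelihood_smul G x hc.ne' u]
    refine hv ⟨fun i => ?_, fun i j => ?_, ?_⟩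
    · have := hu i
      simp only [Pi.smul_apply, smul_eq_mul]; positivity
    · simp only [Pi.smul_apply, smul_eq_mul]
      rw [mul_left_comm]
      exact mul_le_mul_of_nonneg_left ((hK i j u hu hcase).trans
        (mul_le_mul_of_nonneg_right (hKM i j) (hu i).le)) hc.le
    · simp only [Pi.smul_apply, smul_eq_mul]
      rw [← Finset.mul_sum, div_mul_cancel₀ _ hsum.ne']
  · refine (not_le.1 hcase).le.trans ?_
    rw [← likelihood_smul G x (a := s / n) (by positivity) (fun _ => 1)]
    exact hv hAne

/-! ### Deterministic consequences of a small score -/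

theorem sum_score (G : SimpleGraph (Fin n)) [DecidableRel G.Adj] {k : ℕ} (w : Fin n → ℝ)
    (x : Outcomes G k) : ∑ i, score G w x i = 0 := by
  simpa using sum_mul_score G w x (fun _ => 1)

theorem one_le_two_mul_prefProb {w : Fin n → ℝ} {b : ℝ} (hw : ∀ i, 0 < w i)
    (hb : ∀ i j, w i ≤ b * w j) (i j : Fin n) : 1 ≤ 2 * b * prefProb w i j := by
  have hi := hw i
  have hj := hw j
  rw [prefProb, mul_div_assoc', le_div_iff₀ (by positivity)]
  linarith [hb i i, hb j i]

/-- With `r`, `s` the two ratios, `prefProb v i j - prefProb w i j` is `r - s` times a positive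
factor with denominator `r * w i + s * w j`. The factor `r + s` of `r ^ 2 - s ^ 2` compensates this
denominator, so only the range of `w` matters. -/
theorem sq_sub_le_mul_prefProb_sub {v w : Fin n → ℝ} {b : ℝ} (hv : ∀ i, 0 < v i)
    (hw : ∀ i, 0 < w i) (hb : ∀ i j, w i ≤ b * w j) (i j : Fin n) :
    (v i / w i - v j / w j) ^ 2 ≤
      2 * b * ((prefProb v i j - prefProb w i j) * ((v i / w i) ^ 2 - (v j / w j) ^ 2)) := by
  obtain ⟨r, hr, hri⟩ : ∃ r, 0 < r ∧ v i = r * w i :=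
    ⟨v i / w i, div_pos (hv i) (hw i), (div_mul_cancel₀ _ (hw i).ne').symm⟩
  obtain ⟨s, hs, hsj⟩ : ∃ s, 0 < s ∧ v j = s * w j :=
    ⟨v j / w j, div_pos (hv j) (hw j), (div_mul_cancel₀ _ (hw j).ne').symm⟩
  have hi := hw i
  have hj := hw j
  rw [prefProb, prefProb, hri, hsj, mul_div_cancel_right₀ _ hi.ne', mul_div_cancel_right₀ _ hj.ne']
  have h1 : 2 * b * ((r * w i / (r * w i + s * w j) - w i / (w i + w j)) * (r ^ 2 - s ^ 2)) =
      (r - s) ^ 2 * ((2 * b * (w i * w j) * (r + s)) /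
        ((r * w i + s * w j) * (w i + w j))) := by
    field_simp
    ring
  rw [h1]
  refine le_mul_of_one_le_right (sq_nonneg _) ((one_le_div (by positivity)).2 ?_)
  have h2 : r * w i * w i ≤ r * w i * (b * w j) := mul_le_mul_of_nonneg_left (hb i j) (by positivity)
  have h3 : s * w j * w j ≤ s * w j * (b * w i) := mul_le_mul_of_nonneg_left (hb j i) (by positivity)
  have h4 : r * w j * w i ≤ r * w j * (b * w i) := mul_le_mul_of_nonneg_left (hb i i) (by positivity)
  have h5 : s * w j * w i ≤ s * w j * (b * w i) := mul_le_mul_of_nonneg_left (hb i i) (by positivity)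
  linarith

theorem sum_comparisons_eq_mul_dirichletForm (G : SimpleGraph (Fin n)) [DecidableRel G.Adj]
    (k : ℕ) (f : Fin n → ℝ) :
    ∑ c : ComparedPair G × Fin k, (f c.1.1.1 - f c.1.1.2) ^ 2 = k * dirichletForm G f := by
  rw [Fintype.sum_prod_type, dirichletForm, Finset.mul_sum]
  simp

/-- Subtracting the likelihood equation at `v`, tested against the squared ratios, cancels the
observed outcomes and leaves only differences of probabilities. -/
theorem mul_dirichletForm_le_sum_sq_mul_score {G : SimpleGraph (Fin n)} [DecidableRel G.Adj]
    {k : ℕ} {x : Outcomes G k} {v w : Fin n → ℝ} {b : ℝ} (hv : IsMLEstimate G x v)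
    (hw : ∀ i, 0 < w i) (hb : ∀ i j, w i ≤ b * w j) :
    k * dirichletForm G (fun i => v i / w i) ≤
      2 * b * ∑ i, (v i / w i) ^ 2 * score G w x i := by
  have h0 := sum_mul_score_eq_zero hv (fun i => (v i / w i) ^ 2)
  rw [sum_mul_score] at h0
  rw [← sub_zero (∑ i, _), ← h0, sum_mul_score, ← Finset.sum_sub_distrib, Finset.mul_sum,
    ← sum_comparisons_eq_mul_dirichletForm]
  refine Finset.sum_le_sum fun c _ =>
    (sq_sub_le_mul_prefProb_sub hv.1 hw hb c.1.1.1 c.1.1.2).trans (le_of_eq ?_)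
  unfold centeredOutcome
  ring

theorem sum_degree_mul_sub_degreeMean {G : SimpleGraph (Fin n)} [DecidableRel G.Adj]
    (hn : 0 < n) (hd : ∀ i, 0 < G.degree i) (f : Fin n → ℝ) :
    ∑ i, (G.degree i : ℝ) * (f i - degreeMean G f) = 0 := by
  have : Nonempty (Fin n) := ⟨⟨0, hn⟩⟩
  have hvol : ∑ i, (G.degree i : ℝ) ≠ 0 :=
    (Finset.sum_pos (fun i _ => Nat.cast_pos.2 (hd i)) Finset.univ_nonempty).ne'
  simp_rw [mul_sub, Finset.sum_sub_distrib, ← Finset.sum_mul]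
  rw [degreeMean]
  field_simp
  ring

/-- If the score is small, then every proper set of items wins a comparison with another item. -/
theorem exists_beats_of_abs_score_le {G : SimpleGraph (Fin n)} [DecidableRel G.Adj]
    (hn : 2 ≤ n) (hG : G.Connected) {k : ℕ} {x : Outcomes G k} {w : Fin n → ℝ} {b t ε : ℝ}
    (hw : ∀ i, 0 < w i) (hb : ∀ i j, w i ≤ b * w j) (hb0 : 0 < b) (hk : 0 < k)
    (ht : ∀ i, |score G w x i| ≤ t)
    (hε : 2 * b * t ≤ ε * (k * (spectralGap (walkMatrix G) * G.minDegree))) (hε' : ε < 1 / 2)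
    {S : Set (Fin n)} (hS : S.Nonempty) (hS' : Sᶜ.Nonempty) :
    ∃ i ∈ S, ∃ j ∈ Sᶜ, Beats x i j := by
  classical
  by_contra! hcon
  obtain ⟨hγ, hP⟩ := spectralGap_walkMatrix_pos_and_poincare hn hG
  have hd := degree_pos hn hG
  set γ := spectralGap (walkMatrix G)
  set δ : ℝ := (G.minDegree : ℝ)
  let f : Fin n → ℝ := fun i => if i ∈ S then 1 else 0
  set m := degreeMean G f with hm
  have hδ : 0 < δ := by
    have : Nonempty (Fin n) := ⟨⟨0, by omega⟩⟩
    obtain ⟨i, hi⟩ := G.exists_minimal_degree_vertex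
    exact Nat.cast_pos.2 (hi ▸ hd i)
  have hδd : ∀ i, δ ≤ G.degree i := fun i => Nat.cast_le.2 (G.minDegree_le_degree i)
  have hcen := sum_degree_mul_sub_degreeMean (by omega) hd f
  rw [← hm] at hcen
  have hP' := hP f
  rw [← hm] at hP'
  set Q := ∑ i, (G.degree i : ℝ) * (f i - m) ^ 2 with hQ
  have hQ0 : 0 < Q := by
    refine sum_degree_mul_sq_pos hd (h := fun i => f i - m) fun h => ?_
    obtain ⟨i, hi⟩ := hS
    obtain ⟨j, hj⟩ := hS'
    have h1 := congrFun h i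
    have h2 := congrFun h j
    have hj' : j ∉ S := hj
    simp only [f, hi, hj', if_true, if_false, Pi.zero_apply] at h1 h2
    linarith
  -- In a comparison across the cut the member of `S` lost, so its term on the right is the
  -- probability under `w` that this member wins, at least `1 / (2 * b)`.
  have h1 : k * dirichletForm G f ≤ 2 * b * ∑ i, -f i * score G w x i := by
    have h2 := sum_mul_score G w x (fun i => -f i)
    rw [h2, Finset.mul_sum, ← sum_comparisons_eq_mul_dirichletForm]
    refine Finset.sum_le_sum fun c _ => ?_
    have hp := one_le_two_mul_prefProb hw hb c.1.1.1 c.1.1.2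
    have hp' := one_le_two_mul_prefProb hw hb c.1.1.2 c.1.1.1
    have hpp := prefProb_add_prefProb hw c.1.1.1 c.1.1.2
    by_cases hi : c.1.1.1 ∈ S <;> by_cases hj : c.1.1.2 ∈ S
    · simp [f, hi, hj]
    · have hx : x c = false := by
        by_contra hx
        exact hcon _ hi _ hj ⟨c, Or.inl ⟨by simpa using hx, rfl, rfl⟩⟩
      simp only [f, hi, hj, hx, centeredOutcome, if_true, if_false, Bool.false_eq_true]
      linarith
    · have hx : x c = true := by
        by_contra hx
        exact hcon _ hj _ hi ⟨c, Or.inr ⟨by simpa using hx, rfl, rfl⟩⟩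
      simp only [f, hi, hj, hx, centeredOutcome, if_true, if_false]
      rw [eq_sub_of_add_eq hpp]
      linarith
    · simp [f, hi, hj]
  have h2 : ∑ i, -f i * score G w x i ≤ t * ∑ i, |f i - m| := by
    have h3 : ∑ i, -f i * score G w x i = ∑ i, -(f i - m) * score G w x i := by
      have : ∑ i, -(f i - m) * score G w x i =
          ∑ i, -f i * score G w x i + m * ∑ i, score G w x i := by
        rw [Finset.mul_sum, ← Finset.sum_add_distrib]
        exact Finset.sum_congr rfl fun i _ => by ring
      rw [this, sum_score]; ring
    rw [h3, Finset.mul_sum]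
    refine Finset.sum_le_sum fun i _ => ?_
    calc -(f i - m) * score G w x i ≤ |-(f i - m) * score G w x i| := le_abs_self _
      _ = |score G w x i| * |f i - m| := by rw [abs_mul, abs_neg, mul_comm]
      _ ≤ _ := mul_le_mul_of_nonneg_right (ht i) (abs_nonneg _)
  have hm01 : 0 ≤ m ∧ m ≤ 1 := by
    rw [hm, degreeMean]
    constructor
    · refine div_nonneg (Finset.sum_nonneg fun i _ => ?_) (Finset.sum_nonneg fun i _ => ?_)
      · simp only [f]; positivity
      · positivity
    · refine div_le_one_of_le₀ (Finset.sum_le_sum fun i _ => ?_) (Finset.sum_nonneg fun i _ => ?_)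
      · simp only [f]; split_ifs <;> simp
      · positivity
  have h3 : δ * ∑ i, |f i - m| ≤ 2 * Q := by
    have h4 : ∀ i, δ * |f i - m| ≤
        2 * ((G.degree i : ℝ) * (f i - m) ^ 2) - (1 - 2 * m) * ((G.degree i : ℝ) * (f i - m)) := by
      intro i
      -- As `f` takes only the values 0 and 1, the absolute deviation is a quadratic polynomial in
      -- the deviation. Its linear part vanishes after degree-weighted summation.
      have h5 : |f i - m| = 2 * (f i - m) ^ 2 - (1 - 2 * m) * (f i - m) := by
        by_cases hi : i ∈ S
        · simp only [f, hi, if_true]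
          rw [abs_of_nonneg (by linarith)]; ring
        · simp only [f, hi, if_false]
          rw [abs_of_nonpos (by linarith)]; ring
      calc δ * |f i - m| ≤ G.degree i * |f i - m| :=
            mul_le_mul_of_nonneg_right (hδd i) (abs_nonneg _)
        _ = _ := by rw [h5]; ring
    rw [Finset.mul_sum]
    refine (Finset.sum_le_sum fun i _ => h4 i).trans (le_of_eq ?_)
    rw [Finset.sum_sub_distrib, ← Finset.mul_sum, ← Finset.mul_sum, hcen, hQ]
    ring
  have hk' : (0 : ℝ) < k := Nat.cast_pos.2 hk
  set T := ∑ i, |f i - m|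
  have hT : 0 ≤ T := Finset.sum_nonneg fun i _ => abs_nonneg _
  have h5 : k * (γ * Q) ≤ 2 * b * (t * T) :=
    (mul_le_mul_of_nonneg_left hP' hk'.le).trans
      (h1.trans (mul_le_mul_of_nonneg_left h2 (by positivity)))
  have h6 : 2 * b * t * T ≤ ε * (k * (γ * δ)) * T := mul_le_mul_of_nonneg_right hε hT
  have hkγ : 0 < k * γ := by positivity
  have h7 : k * γ * Q ≤ k * γ * (ε * (δ * T)) := by linarith
  have h8 := le_of_mul_le_mul_left h7 hkγ
  have h9 : 0 < δ * T := by
    by_contra hcon'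
    have h10 : δ * T = 0 := le_antisymm (not_lt.1 hcon') (by positivity)
    rw [h10] at h8
    linarith
  -- Contradiction: `δ * T ≤ 2 * Q ≤ 2 * ε * (δ * T) < δ * T`.
  nlinarith

/-- The score sums to zero, so `r ^ 2` may be replaced by `r ^ 2 - m ^ 2 = (r - m) ^ 2 + 2 * m * (r
- m)`. The quadratic part is absorbed on the left because `ε ≤ 1 / 2`; Cauchy-Schwarz handles the
linear part. -/
theorem sum_sq_sub_degreeMean_le {G : SimpleGraph (Fin n)} [DecidableRel G.Adj]
    (hn : 2 ≤ n) (hG : G.Connected) {k : ℕ} {x : Outcomes G k} {v w : Fin n → ℝ} {b t ε : ℝ}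
    (hw : ∀ i, 0 < w i) (hb : ∀ i j, w i ≤ b * w j) (hb0 : 0 < b) (hk : 0 < k)
    (ht : ∀ i, |score G w x i| ≤ t) (hε0 : 0 ≤ ε)
    (hε : 2 * b * t ≤ ε * (k * (spectralGap (walkMatrix G) * G.minDegree))) (hε' : ε ≤ 1 / 2)
    (hv : IsMLEstimate G x v) {m : ℝ} (hm : m = degreeMean G (fun i => v i / w i)) :
    ∑ i, (v i / w i - m) ^ 2 ≤ 16 * ε ^ 2 * m ^ 2 * n := by
  obtain ⟨hγ, hP⟩ := spectralGap_walkMatrix_pos_and_poincare hn hG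
  have hd := degree_pos hn hG
  set γ := spectralGap (walkMatrix G)
  set δ : ℝ := (G.minDegree : ℝ)
  have hδ : 0 < δ := by
    have : Nonempty (Fin n) := ⟨⟨0, by omega⟩⟩
    obtain ⟨i, hi⟩ := G.exists_minimal_degree_vertex
    exact Nat.cast_pos.2 (hi ▸ hd i)
  have hδd : ∀ i, δ ≤ G.degree i := fun i => Nat.cast_le.2 (G.minDegree_le_degree i)
  have hk' : (0 : ℝ) < k := Nat.cast_pos.2 hk
  have hP' := hP (fun i => v i / w i)
  rw [← hm] at hP'
  have hm0 : 0 ≤ m := by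
    rw [hm, degreeMean]
    refine div_nonneg (Finset.sum_nonneg fun i _ => ?_) (Finset.sum_nonneg fun i _ => ?_)
    · have := hv.1 i; have := hw i; positivity
    · positivity
  have h1 := mul_dirichletForm_le_sum_sq_mul_score hv hw hb
  set r : Fin n → ℝ := fun i => v i / w i with hr
  change ∑ i, (r i - m) ^ 2 ≤ _
  change _ ≤ 2 * b * ∑ i, r i ^ 2 * score G w x i at h1
  change γ * ∑ i, (G.degree i : ℝ) * (r i - m) ^ 2 ≤ _ at hP'
  set E := ∑ i, (r i - m) ^ 2 with hE
  set T := ∑ i, |r i - m| with hT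
  have hE0 : 0 ≤ E := Finset.sum_nonneg fun i _ => sq_nonneg _
  have hT0 : 0 ≤ T := Finset.sum_nonneg fun i _ => abs_nonneg _
  have hTE : T ^ 2 ≤ n * E := by
    have := sq_sum_le_card_mul_sum_sq (s := Finset.univ) (f := fun i => |r i - m|)
    simpa [sq_abs] using this
  have h2 : ∑ i, r i ^ 2 * score G w x i ≤ t * (E + 2 * m * T) := by
    have h3 : ∑ i, r i ^ 2 * score G w x i =
        ∑ i, ((r i - m) ^ 2 + 2 * m * (r i - m)) * score G w x i := by
      have : ∑ i, ((r i - m) ^ 2 + 2 * m * (r i - m)) * score G w x i =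
          ∑ i, r i ^ 2 * score G w x i - m ^ 2 * ∑ i, score G w x i := by
        rw [Finset.mul_sum, ← Finset.sum_sub_distrib]
        exact Finset.sum_congr rfl fun i _ => by ring
      rw [this, sum_score]; ring
    rw [h3, hE, hT, Finset.mul_sum, ← Finset.sum_add_distrib, Finset.mul_sum]
    refine Finset.sum_le_sum fun i _ => ?_
    have h4 : |(r i - m) ^ 2 + 2 * m * (r i - m)| ≤ (r i - m) ^ 2 + 2 * m * |r i - m| := by
      refine (abs_add_le _ _).trans (le_of_eq ?_)
      rw [abs_of_nonneg (sq_nonneg _), abs_mul, abs_of_nonneg (by positivity : 0 ≤ 2 * m)]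
    calc _ ≤ |((r i - m) ^ 2 + 2 * m * (r i - m)) * score G w x i| := le_abs_self _
      _ = |score G w x i| * |(r i - m) ^ 2 + 2 * m * (r i - m)| := by rw [abs_mul, mul_comm]
      _ ≤ _ := mul_le_mul (ht i) h4 (abs_nonneg _) ((abs_nonneg _).trans (ht i))
  have h3 : δ * E ≤ ∑ i, (G.degree i : ℝ) * (r i - m) ^ 2 := by
    rw [hE, Finset.mul_sum]
    exact Finset.sum_le_sum fun i _ => mul_le_mul_of_nonneg_right (hδd i) (sq_nonneg _)
  set Z := E + 2 * m * T with hZ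
  have hZ0 : 0 ≤ Z := by positivity
  have h4 : k * (γ * (δ * E)) ≤ 2 * b * (t * Z) :=
    (mul_le_mul_of_nonneg_left ((mul_le_mul_of_nonneg_left h3 hγ.le).trans hP') hk'.le).trans
      (h1.trans (mul_le_mul_of_nonneg_left h2 (by positivity)))
  have h5 : 2 * b * t * Z ≤ ε * (k * (γ * δ)) * Z := mul_le_mul_of_nonneg_right hε hZ0
  have h6 : E ≤ ε * Z := by
    refine le_of_mul_le_mul_left ?_ (by positivity : 0 < k * (γ * δ))
    linarith
  have h7 : E ≤ 4 * ε * m * T := by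
    have : ε * E ≤ 1 / 2 * E := mul_le_mul_of_nonneg_right hε' hE0
    rw [hZ] at h6
    linarith
  rcases hE0.eq_or_lt with h0 | h0
  · rw [← h0]; positivity
  · refine le_of_mul_le_mul_left ?_ h0
    calc E * E ≤ (4 * ε * m * T) * (4 * ε * m * T) := mul_le_mul h7 h7 hE0 (by positivity)
      _ = 16 * ε ^ 2 * m ^ 2 * T ^ 2 := by ring
      _ ≤ 16 * ε ^ 2 * m ^ 2 * (n * E) := mul_le_mul_of_nonneg_left hTE (by positivity)
      _ = _ := by ring

/-- The error of weights `r * w` of the same sum as `w`, in terms of the variation of the ratios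
`r` about some `m`. -/
theorem sum_sq_sub_le_of_sum_eq {v w : Fin n → ℝ} {b ε m : ℝ} (hn : 0 < n)
    (hw : ∀ i, 0 < w i) (hw1 : ∀ i, w i ≤ 1) (hwb : ∀ i, 1 / b ≤ w i) (hb0 : 0 < b)
    (hbε : 64 * ε ^ 2 * b ≤ 1) (hsum : ∑ i, v i = ∑ i, w i) (hm : 0 ≤ m)
    (hE : ∑ i, (v i / w i - m) ^ 2 ≤ 16 * ε ^ 2 * m ^ 2 * n) :
    ∑ i, (v i - w i) ^ 2 ≤ (16 * ε) ^ 2 * n := by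
  have hne : Nonempty (Fin n) := ⟨⟨0, hn⟩⟩
  have hn' : (0 : ℝ) < n := Nat.cast_pos.2 hn
  set E := ∑ i, (v i / w i - m) ^ 2 with hEdef
  have hE0 : 0 ≤ E := Finset.sum_nonneg fun i _ => sq_nonneg _
  set W := ∑ i, w i with hW
  set W2 := ∑ i, w i ^ 2 with hW2
  have hW0 : 0 < W := Finset.sum_pos (fun i _ => hw i) Finset.univ_nonempty
  have hW20 : 0 ≤ W2 := Finset.sum_nonneg fun i _ => sq_nonneg _
  have hWW : W2 ≤ W := Finset.sum_le_sum fun i _ => by nlinarith [hw i, hw1 i]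
  have hWn : n ≤ b * W := by
    have : ∑ _i : Fin n, 1 / b ≤ W := Finset.sum_le_sum fun i _ => hwb i
    simp only [Finset.sum_const, Finset.card_univ, Fintype.card_fin, nsmul_eq_mul] at this
    rw [mul_one_div, div_le_iff₀ hb0] at this
    linarith
  have hvw : ∀ i, v i - w i = w i * (v i / w i - m) + (m - 1) * w i := by
    intro i
    have := (hw i).ne'
    field_simp
    ring
  -- Equality of the sums means that the `w`-weighted sum of `v i / w i - m` is `-(m - 1) * W`;
  -- Cauchy-Schwarz follows.
  have hCS : (m - 1) ^ 2 * W ^ 2 ≤ W2 * E := by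
    have h1 : ∑ i, w i * (v i / w i - m) = -((m - 1) * W) := by
      have h2 : ∑ i, (v i - w i) = 0 := by rw [Finset.sum_sub_distrib, hsum, sub_self]
      simp_rw [hvw] at h2
      rw [Finset.sum_add_distrib, ← Finset.mul_sum] at h2
      linarith
    have := Finset.sum_mul_sq_le_sq_mul_sq Finset.univ w (fun i => v i / w i - m)
    rw [h1] at this
    linarith
  -- The bound on `E` itself contains `m`; the smallness of `ε ^ 2 * b` yields `|m - 1| ≤ m / 2`.
  have hm2 : m ≤ 2 := by
    have h1 : (m - 1) ^ 2 * W ≤ E := by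
      refine le_of_mul_le_mul_right ?_ hW0
      have := mul_le_mul_of_nonneg_right hWW hE0
      linarith
    have h2 : (m - 1) ^ 2 * n ≤ (m / 2) ^ 2 * n := by
      calc (m - 1) ^ 2 * n ≤ (m - 1) ^ 2 * (b * W) :=
            mul_le_mul_of_nonneg_left hWn (sq_nonneg _)
        _ = b * ((m - 1) ^ 2 * W) := by ring
        _ ≤ b * (16 * ε ^ 2 * m ^ 2 * n) := mul_le_mul_of_nonneg_left (h1.trans hE) hb0.le
        _ = (64 * ε ^ 2 * b) * ((m / 2) ^ 2 * n) := by ring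
        _ ≤ _ := mul_le_of_le_one_left (by positivity) hbε
    have h3 := abs_le_of_sq_le_sq (le_of_mul_le_mul_right h2 hn') (by positivity)
    linarith [le_abs_self (m - 1)]
  have h1 : (m - 1) ^ 2 * W2 ≤ E := by
    refine le_of_mul_le_mul_right ?_ (by positivity : 0 < W ^ 2)
    calc (m - 1) ^ 2 * W2 * W ^ 2 = W2 * ((m - 1) ^ 2 * W ^ 2) := by ring
      _ ≤ W2 * (W2 * E) := mul_le_mul_of_nonneg_left hCS hW20
      _ = E * W2 ^ 2 := by ring
      _ ≤ E * W ^ 2 := by gcongr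
  have h2 : ∑ i, (v i - w i) ^ 2 ≤ 4 * E := by
    calc ∑ i, (v i - w i) ^ 2
        ≤ ∑ i, (2 * (v i / w i - m) ^ 2 + 2 * (m - 1) ^ 2 * w i ^ 2) := by
          refine Finset.sum_le_sum fun i _ => ?_
          rw [hvw]
          have h3 : w i ^ 2 ≤ 1 := pow_le_one₀ (hw i).le (hw1 i)
          have h4 := mul_le_mul_of_nonneg_right h3 (sq_nonneg (v i / w i - m))
          nlinarith [sq_nonneg (w i * (v i / w i - m) - (m - 1) * w i)]
      _ = 2 * E + 2 * ((m - 1) ^ 2 * W2) := by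
          rw [Finset.sum_add_distrib, ← Finset.mul_sum, ← Finset.mul_sum]; ring
      _ ≤ 4 * E := by linarith
  calc _ ≤ 4 * (16 * ε ^ 2 * m ^ 2 * n) := h2.trans (by linarith)
    _ ≤ 4 * (16 * ε ^ 2 * 2 ^ 2 * n) := by gcongr
    _ = _ := by ring

/-! ### Choice of constants and conclusion -/

theorem div_le_dynamicRange (w : Fin n → ℝ) (i j : Fin n) : w i / w j ≤ dynamicRange w :=
  le_ciSup (f := fun p : Fin n × Fin n => w p.1 / w p.2) (Set.finite_range _).bddAbove (i, j)

end BradleyTerry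

end

theorem mainTheorem3 :
    ∃ C c α : ℝ, 0 < C ∧ 0 < c ∧ 0 < α ∧
      ∀ (n : ℕ), 2 ≤ n →
      ∀ (G : SimpleGraph (Fin n)) [DecidableRel G.Adj], G.Connected →
      ∀ (w : Fin n → ℝ) (b dmax κ γ : ℝ),
        b = BradleyTerry.dynamicRange w →
        (∀ i, 0 < w i) →
        (∀ i, w i ∈ Set.Icc (1 / b) 1) →
        dmax = (G.maxDegree : ℝ) →
        κ = (G.maxDegree : ℝ) / (G.minDegree : ℝ) →
        γ = BradleyTerry.spectralGap (BradleyTerry.walkMatrix G) →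
      ∀ (k : ℕ), (k : ℝ) ≥ 4 * C ^ 2 * (1 + b ^ 6 * κ ^ 2 / (dmax * γ ^ 2) * Real.log n) →
        1 - c / (n : ℝ) ^ α ≤
          (BradleyTerry.outcomeLaw G k w).real
            {x | (∃ v, BradleyTerry.IsScaledMLEstimate G w x v) ∧
              ∀ v, BradleyTerry.IsScaledMLEstimate G w x v →
                ‖(WithLp.toLp 2 (v - w) : EuclideanSpace ℝ (Fin n))‖ <
                  C * (b ^ 4 * κ / γ) * Real.sqrt (n * Real.log n / (k * dmax))} := by
  refine ⟨100, 2, 1, by norm_num, by norm_num, one_pos, ?_⟩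
  intro n hn G _ hG w b dmax κ γ hb hw hwb hdmax hκ hγ k hk
  have hne : Nonempty (Fin n) := ⟨⟨0, by omega⟩⟩
  have hn0 : (0 : ℝ) < n := by positivity
  have hlog : 0 < Real.log n := Real.log_pos (by exact_mod_cast hn)
  have hγ0 : 0 < γ := hγ ▸ (BradleyTerry.spectralGap_walkMatrix_pos_and_poincare hn hG).1
  have hbw : ∀ i j, w i ≤ b * w j := fun i j =>
    (div_le_iff₀ (hw j)).1 (hb ▸ BradleyTerry.div_le_dynamicRange w i j)
  have hb1 : 1 ≤ b := by
    obtain ⟨i⟩ := hne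
    rw [hb, ← div_self (hw i).ne']
    exact BradleyTerry.div_le_dynamicRange w i i
  have hb0 : 0 < b := by linarith
  have hdmin : (0 : ℝ) < G.minDegree := by
    obtain ⟨i, hi⟩ := G.exists_minimal_degree_vertex
    exact Nat.cast_pos.2 (hi ▸ BradleyTerry.degree_pos hn hG i)
  have hd0 : 0 < dmax :=
    hdmax ▸ hdmin.trans_le (Nat.cast_le.2 G.minDegree_le_maxDegree)
  have hκd : κ * G.minDegree = dmax := by rw [hκ, hdmax, div_mul_cancel₀ _ hdmin.ne']
  have hκ0 : 0 < κ := by rw [hκ, ← hdmax]; positivity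
  have hk0 : (0 : ℝ) < k := lt_of_lt_of_le (by positivity) hk
  have hk0' : 0 < k := Nat.cast_pos.1 hk0
  set q := √(Real.log n / (k * dmax)) with hq
  have hq0 : 0 < q := Real.sqrt_pos.2 (by positivity)
  have hq2 : q ^ 2 = Real.log n / (k * dmax) := Real.sq_sqrt (by positivity)
  have ht : √(k * G.maxDegree * Real.log n) = k * dmax * q := by
    have h : (k * dmax * Real.log n : ℝ) = (k * dmax * q) ^ 2 := by
      rw [mul_pow, hq2]
      field_simp
    rw [← hdmax, h, Real.sqrt_sq (by positivity)]
  -- Chosen to give equality in `hεt`, where the score threshold is `k * dmax * q`.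
  set ε := 2 * b * κ * q / γ with hε
  have hε0 : 0 < ε := by positivity
  -- Squared, this is the lower bound on `k` with `C = 100`, without the summand 1; it is the source
  -- of `b ^ 6`.
  have hεb : 100 * b ^ 2 * ε ≤ 1 := by
    have h1 : (100 * b ^ 2 * ε) ^ 2 ≤ 1 := by
      have h2 : (100 * b ^ 2 * ε) ^ 2 =
          (4 * 100 ^ 2 * (b ^ 6 * κ ^ 2 / (dmax * γ ^ 2) * Real.log n)) / k := by
        calc (100 * b ^ 2 * ε) ^ 2 = 4 * 100 ^ 2 * (b ^ 6 * κ ^ 2 / γ ^ 2) * q ^ 2 := by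
              rw [hε]; field_simp; ring
          _ = _ := by rw [hq2]; field_simp
      rw [h2, div_le_one hk0]
      linarith
    exact (sq_le_one_iff₀ (by positivity)).1 h1
  have hb2 : 1 ≤ b ^ 2 := one_le_pow₀ hb1
  have hε1 : ε ≤ 1 / 100 := by nlinarith
  have hbε : 64 * ε ^ 2 * b ≤ 1 := by nlinarith
  have hεt : 2 * b * (k * dmax * q) ≤
      ε * (k * (BradleyTerry.spectralGap (BradleyTerry.walkMatrix G) * G.minDegree)) := by
    rw [← hγ, ← hκd, hε]
    refine le_of_eq ?_
    field_simp
  have hprob := BradleyTerry.isProbabilityMeasure_outcomeLaw G k hw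
  have htail := BradleyTerry.measureReal_exists_lt_abs_score_le hn hG hk0' hw
  rw [ht] at htail
  set B := {x : BradleyTerry.Outcomes G k | ∃ i, k * dmax * q < |BradleyTerry.score G w x i|}
  have hcompl : 1 - 2 / (n : ℝ) ^ (1 : ℝ) ≤ (BradleyTerry.outcomeLaw G k w).real Bᶜ := by
    rw [Real.rpow_one, probReal_compl_eq_one_sub (Set.toFinite B).measurableSet]
    linarith
  refine hcompl.trans (measureReal_mono ?_)
  intro x hx
  have hsc : ∀ i, |BradleyTerry.score G w x i| ≤ k * dmax * q := by
    intro i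
    by_contra hcon
    exact hx ⟨i, not_le.1 hcon⟩
  have hW : 0 < ∑ i, w i := Finset.sum_pos (fun i _ => hw i) Finset.univ_nonempty
  refine ⟨BradleyTerry.exists_isMLEstimate_sum_eq (by omega) (fun S hS hS' =>
    BradleyTerry.exists_beats_of_abs_score_le hn hG hw hbw hb0 hk0' hsc hεt (by linarith) hS hS')
    hW, fun v hv => ?_⟩
  have hE := BradleyTerry.sum_sq_sub_degreeMean_le hn hG hw hbw hb0 hk0' hsc hε0.le hεt
    (by linarith) hv.1 rfl
  have hm : 0 ≤ BradleyTerry.degreeMean G (fun i => v i / w i) :=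
    div_nonneg (Finset.sum_nonneg fun i _ => mul_nonneg (Nat.cast_nonneg _)
      (div_pos (hv.1.1 i) (hw i)).le) (Finset.sum_nonneg fun i _ => Nat.cast_nonneg _)
  have hfin := BradleyTerry.sum_sq_sub_le_of_sum_eq (by omega) hw (fun i => (hwb i).2)
    (fun i => (hwb i).1) hb0 hbε hv.2 hm hE
  have hsqrt : √(n * Real.log n / (k * dmax)) = √n * q := by
    rw [hq, ← Real.sqrt_mul hn0.le, mul_div_assoc]
  have hsn : 0 < √(n : ℝ) := Real.sqrt_pos.2 hn0
  rw [EuclideanSpace.norm_eq, hsqrt]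
  calc √(∑ i, ‖(v - w) i‖ ^ 2) ≤ √((16 * ε) ^ 2 * n) := by
        refine Real.sqrt_le_sqrt ?_
        simpa using hfin
    _ = 16 * ε * √n := by rw [Real.sqrt_mul (sq_nonneg _), Real.sqrt_sq (by positivity)]
    _ = 32 * (b * κ / γ) * (√n * q) := by rw [hε]; ring
    -- The argument gives the first power of `b`; `b ≤ b ^ 4` and `32 < 100` leave room for
    -- strictness.
    _ < 100 * (b ^ 4 * κ / γ) * (√n * q) := by
        have h1 : b ≤ b ^ 4 := le_self_pow₀ hb1 (by norm_num)
        have h2 : b * κ / γ ≤ b ^ 4 * κ / γ := by gcongr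
        have h3 : 0 < b * κ / γ := by positivity
        exact mul_lt_mul_of_pos_right (by linarith) (by positivity)
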